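/- Let $m\ge 0$ be a fixed integer. For each $n\ge 1$ let $X_{n1},\dots,X_{nN_n}$ (with $N_n\ge1$) be real random variables defined on a common probability space (which may depend on $n$), and suppose that each row is $m$-dependent, i.e. for every integer $k$ the families $\{X_{ni}\}_{i\le k}$ and $\{X_{ni}\}_{i>k+m}$ are independent of each other. Suppose that all $X_{ni}$ have finite second moments and $\mathbb{E}X_{ni}=0$. Let $S_n:=\sum_{i=1}^{N_n}X_{ni}$ and $\sigma_n^2:=\operatorname{Var}S_n$, with $\sigma_n\ge0$, and assume that $\sigma_n^2>0$ for all large $n$. Assume the Lindeberg condition: for every $\varepsilon>0$, $$\frac{1}{\sigma_n^2}\sum_{i=1}^{N_n}\mathbb{E}\bigl[X_{ni}^2\,\mathbf{1}\{|X_{ni}|>\varepsilon\sigma_n\}\bigr]\to 0\qquad\text{as } n\to\infty.$$ Then $S_n/\sigma_n\to N(0,1)$ in distribution as $n\to\infty$. -/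

import Mathlib

open MeasureTheory ProbabilityTheory Filter Topology

/-- A finite sequence `X 0, …, X (N - 1)` of random variables is `m`-dependent under `μ` if, for
every `k`, the family of its first `k` members is independent of the family of all members coming
after the first `k + m` ones. -/
def IsMDependent {Ω : Type*} [MeasurableSpace Ω] (μ : Measure Ω) {N : ℕ} (m : ℕ)
    (X : Fin N → Ω → ℝ) : Prop :=
  ∀ k : ℕ, IndepFun
    (fun ω (i : {i : Fin N // (i : ℕ) < k}) => X i ω)
    (fun ω (i : {i : Fin N // k + m ≤ (i : ℕ)}) => X i ω) μ

/-- The sum `S` of a finite sequence of random variables. -/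
def rowSum {Ω : Type*} {N : ℕ} (X : Fin N → Ω → ℝ) (ω : Ω) : ℝ :=
  ∑ i, X i ω

/-- The standard deviation `σ = √(Var S)` of the sum of a finite sequence of random variables. -/
noncomputable def rowSd {Ω : Type*} [MeasurableSpace Ω] (μ : Measure Ω) {N : ℕ}
    (X : Fin N → Ω → ℝ) : ℝ :=
  √(Var[rowSum X; μ])

/-! By Lévy's continuity theorem it suffices to bound the distance of characteristic functions at
each fixed `t`, uniformly over all normalized rows with a small enough Lindeberg sum.

Truncation and recentring (`exists_lindeberg_norm_rvCharFun_segSum_sub_le`) reduce this to variables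
bounded by a small `δ` whose sum has variance close to 1: by `m`-dependence the removed part has
second moment at most `2 * m + 1` times the Lindeberg sum.

For bounded variables, a block is cut off as soon as the variance of its sum reaches `η`, and the
next `m` members are deleted, which makes the block independent of the remaining tail. The gap is
bounded by `m * δ`, negligible against `η`, so every cut lowers the variance of the tail by at least
`η / 2` and there are only `O(1 / η)` blocks. Replacing the characteristic function of each block by
the Gaussian one, with error `o(η)` per block, gives the result (`norm_rvCharFun_tail_sub_le`).

The delicate point is that error. The variances of single members may add up to far more than the
variance of the sum, so a Lindeberg bound for a block cannot be read off from its members. It comes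
from `setIntegral_sq_segSum_le`, an inequality of Ottaviani type: a large block sum forces an early
exit of the partial sums from `[-l, l]` and then a large, nearly independent, remainder. Both
factors cost `v`, whence a bound of order `v ^ 2 / l ^ 2`. -/

/-! ### Segments of `m`-dependent sequences -/

section Segments

variable {Ω : Type*} {x : ℕ → Ω → ℝ} {m : ℕ} {δ : ℝ}

/-- The sum of the members `x a, …, x (b - 1)` of a sequence of random variables. -/
def segSum (x : ℕ → Ω → ℝ) (a b : ℕ) (ω : Ω) : ℝ :=
  ∑ i ∈ Finset.Ico a b, x i ω

/-- The σ-algebra generated by the members of a sequence with index in `s`. -/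
abbrev familySigma (x : ℕ → Ω → ℝ) (s : Set ℕ) : MeasurableSpace Ω :=
  ⨆ i ∈ s, MeasurableSpace.comap (x i) inferInstance

theorem measurable_familySigma {s : Set ℕ} {i : ℕ} (hi : i ∈ s) :
    Measurable[familySigma x s] (x i) :=
  Measurable.mono (comap_measurable (x i)) (le_iSup₂_of_le i hi le_rfl) le_rfl

theorem measurable_segSum_familySigma {s : Set ℕ} {a b : ℕ}
    (h : ∀ i ∈ Finset.Ico a b, i ∈ s) : Measurable[familySigma x s] (segSum x a b) :=
  @Finset.measurable_fun_sum ℝ _ Ω _ _ _ (familySigma x s) _ _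
    fun i hi => measurable_familySigma (h i hi)

theorem segSum_of_le {a b : ℕ} (h : b ≤ a) (ω : Ω) : segSum x a b ω = 0 := by
  simp [segSum, Finset.Ico_eq_empty_of_le h]

theorem segSum_add {a b c : ℕ} (hab : a ≤ b) (hbc : b ≤ c) (ω : Ω) :
    segSum x a b ω + segSum x b c ω = segSum x a c ω :=
  Finset.sum_Ico_consecutive _ hab hbc

theorem abs_segSum_le (hb : ∀ i ω, |x i ω| ≤ δ) (a b : ℕ) (ω : Ω) :
    |segSum x a b ω| ≤ (b - a : ℕ) * δ := by
  calc |segSum x a b ω| ≤ ∑ i ∈ Finset.Ico a b, |x i ω| := Finset.abs_sum_le_sum_abs _ _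
    _ ≤ ∑ i ∈ Finset.Ico a b, δ := Finset.sum_le_sum fun i _ => hb i ω
    _ = (b - a : ℕ) * δ := by simp

/-- The cost of deleting a gap of `m` members. If `b` lies inside the gap, the shortened segment is
empty and the bound persists. -/
theorem abs_segSum_sub_segSum_le (hδ : 0 ≤ δ) (hb : ∀ i ω, |x i ω| ≤ δ) (c b : ℕ) (ω : Ω) :
    |segSum x c b ω - segSum x (c + m) b ω| ≤ m * δ := by
  rcases le_total (c + m) b with h | h
  · rw [← segSum_add (Nat.le_add_right c m) h, add_sub_cancel_right]
    simpa using abs_segSum_le hb c (c + m) ω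
  · rw [segSum_of_le h, sub_zero]
    refine (abs_segSum_le hb c b ω).trans ?_
    gcongr
    omega

/-- The event that the partial sums started at `a` leave `[-l, l]` at time `c` for the first
time. -/
def firstExit (x : ℕ → Ω → ℝ) (a : ℕ) (l : ℝ) (c : ℕ) : Set Ω :=
  {ω | (∀ j < c, |segSum x a j ω| ≤ l) ∧ l < |segSum x a c ω|}

theorem measurableSet_firstExit (a : ℕ) (l : ℝ) (c : ℕ) :
    MeasurableSet[familySigma x (Set.Iio c)] (firstExit x a l c) := by
  have hj (j : ℕ) (hj : j ≤ c) : Measurable[familySigma x (Set.Iio c)] (segSum x a j) :=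
    measurable_segSum_familySigma fun i hi =>
      Set.mem_Iio.2 ((Finset.mem_Ico.1 hi).2.trans_le hj)
  have h1 : firstExit x a l c =
      (⋂ j ∈ Finset.range c, segSum x a j ⁻¹' {y | |y| ≤ l}) ∩ segSum x a c ⁻¹' {y | l < |y|} := by
    ext ω
    simp [firstExit]
  rw [h1]
  refine MeasurableSet.inter (Finset.measurableSet_biInter _ fun j hjc => ?_) ?_
  · exact hj j (Finset.mem_range.1 hjc).le (measurableSet_le measurable_norm measurable_const)
  · exact hj c le_rfl (measurableSet_lt measurable_const measurable_norm)

theorem exists_mem_firstExit {a b : ℕ} {l : ℝ} {ω : Ω} (h : l < |segSum x a b ω|) :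
    ∃ c ≤ b, ω ∈ firstExit x a l c := by
  classical
  have hex : ∃ c, l < |segSum x a c ω| := ⟨b, h⟩
  exact ⟨Nat.find hex, Nat.find_min' hex h,
    fun j hj => not_lt.1 (Nat.find_min hex hj), Nat.find_spec hex⟩

theorem firstExit_unique {a c d : ℕ} {l : ℝ} {ω : Ω} (hc : ω ∈ firstExit x a l c)
    (hd : ω ∈ firstExit x a l d) : c = d := by
  rcases lt_trichotomy c d with h | h | h
  · exact absurd (hd.1 c h) (not_le.2 hc.2)
  · exact h
  · exact absurd (hc.1 d h) (not_le.2 hd.2)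

/-- Segments ending at or before `a` are empty sums, so no exit occurs there; the exiting step
overshoots by at most one member. -/
theorem abs_segSum_le_of_mem_firstExit (hb : ∀ i ω, |x i ω| ≤ δ) {a c : ℕ} {l : ℝ} (hl : 0 ≤ l)
    {ω : Ω} (h : ω ∈ firstExit x a l c) : a < c ∧ |segSum x a c ω| ≤ l + δ := by
  have hac : a < c := by
    by_contra hca
    have := h.2
    rw [segSum_of_le (not_lt.1 hca), abs_zero] at this
    linarith
  refine ⟨hac, ?_⟩
  obtain ⟨d, rfl⟩ : ∃ d, c = d + 1 := ⟨c - 1, by omega⟩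
  rw [← segSum_add (Nat.lt_succ_iff.1 hac) (Nat.le_succ d)]
  refine (abs_add_le _ _).trans (add_le_add (h.1 d (Nat.lt_succ_self d)) ?_)
  simpa [segSum] using hb d ω

theorem sum_indicator_firstExit_le_one (a n : ℕ) (l : ℝ) (ω : Ω) :
    ∑ c ∈ Finset.range n, (firstExit x a l c).indicator (fun _ => (1 : ℝ)) ω ≤ 1 := by
  by_cases h : ∃ d, ω ∈ firstExit x a l d
  · obtain ⟨d, hd⟩ := h
    calc ∑ c ∈ Finset.range n, (firstExit x a l c).indicator (fun _ => (1 : ℝ)) ω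
        ≤ ∑ c ∈ Finset.range n, if c = d then (1 : ℝ) else 0 := by
          refine Finset.sum_le_sum fun c _ => ?_
          split_ifs with hcd
          · exact Set.indicator_le_self' (by simp) ω
          · rw [Set.indicator_of_notMem fun hc => hcd (firstExit_unique hc hd)]
      _ ≤ 1 := by
          rw [Finset.sum_ite_eq']
          split_ifs <;> norm_num
  · rw [Finset.sum_eq_zero fun c _ => Set.indicator_of_notMem (fun hc => h ⟨c, hc⟩) _]
    exact zero_le_one

variable [MeasurableSpace Ω] {μ : Measure Ω}

/-- An infinite sequence of random variables is `m`-dependent. -/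
def MDepSeq (μ : Measure Ω) (m : ℕ) (x : ℕ → Ω → ℝ) : Prop :=
  ∀ k, Indep (familySigma x (Set.Iio k)) (familySigma x (Set.Ici (k + m))) μ

theorem measurable_segSum (hx : ∀ i, Measurable (x i)) (a b : ℕ) :
    Measurable (segSum x a b) :=
  Finset.measurable_fun_sum _ fun i _ => hx i

theorem MDepSeq.indepFun {β γ : Type*} [MeasurableSpace β] [MeasurableSpace γ]
    (h : MDepSeq μ m x) (k : ℕ) {f : Ω → β} {g : Ω → γ}
    (hf : Measurable[familySigma x (Set.Iio k)] f)
    (hg : Measurable[familySigma x (Set.Ici (k + m))] g) : IndepFun f g μ := by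
  rw [IndepFun_iff_Indep]
  exact indep_of_indep_of_le (h k) hf.comap_le hg.comap_le

/-- The function may vary with the index because truncated variables are recentred by individual
constants. -/
theorem MDepSeq.comp (h : MDepSeq μ m x) {g : ℕ → ℝ → ℝ} (hg : ∀ i, Measurable (g i)) :
    MDepSeq μ m (fun i => g i ∘ x i) := by
  have hle (s : Set ℕ) : familySigma (fun i => g i ∘ x i) s ≤ familySigma x s :=
    iSup₂_mono fun i _ => by
      rw [← MeasurableSpace.comap_comp]
      exact MeasurableSpace.comap_mono (hg i).comap_le
  exact fun k => indep_of_indep_of_le (h k) (hle _) (hle _)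

theorem integrable_of_abs_le [IsFiniteMeasure μ] {f : Ω → ℝ} (hf : Measurable f) {C : ℝ}
    (h : ∀ ω, |f ω| ≤ C) : Integrable f μ :=
  Integrable.of_bound hf.aestronglyMeasurable C (Eventually.of_forall h)

theorem familySigma_le (hx : ∀ i, Measurable (x i)) (s : Set ℕ) :
    familySigma x s ≤ ‹MeasurableSpace Ω› :=
  iSup₂_le fun i _ => (hx i).comap_le

/-- If all final segments of an `m`-dependent block of small variables have second moment at most
`v`, then the square of the sum of the block is uniformly integrable at scale `v`. -/
theorem setIntegral_sq_segSum_le [IsProbabilityMeasure μ] (hx : ∀ i, Measurable (x i))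
    (hdep : MDepSeq μ m x) (hδ : 0 ≤ δ) (hb : ∀ i ω, |x i ω| ≤ δ) {a b : ℕ} {v l : ℝ}
    (hl : 0 < l) (hml : 3 * ((m + 1) * δ) ≤ l) (hvl : 18 * v ≤ l ^ 2)
    (hv : ∀ c, a ≤ c → ∫ ω, segSum x c b ω ^ 2 ∂μ ≤ v) :
    ∫ ω, {ω | 3 * l < |segSum x a b ω|}.indicator (fun ω => segSum x a b ω ^ 2) ω ∂μ
      ≤ 162 * v ^ 2 / l ^ 2 := by
  have hmδ : (m : ℝ) * δ + δ ≤ l / 3 := by linarith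
  have hmδ0 : 0 ≤ (m : ℝ) * δ := by positivity
  let I : ℕ → Ω → ℝ := fun c => (firstExit x a l c).indicator fun _ => 1
  have hA c : MeasurableSet (firstExit x a l c) :=
    familySigma_le hx _ _ (measurableSet_firstExit a l c)
  have hI c : Measurable (I c) := measurable_const.indicator (hA c)
  have hI0 c ω : 0 ≤ I c ω := Set.indicator_nonneg (by simp) ω
  have hI1 c ω : I c ω ≤ 1 := Set.indicator_le_self' (by simp) ω
  have hint c d : Integrable (fun ω => segSum x c d ω ^ 2) μ :=
    integrable_of_abs_le ((measurable_segSum hx c d).pow_const 2)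
      (C := ((d - c : ℕ) * δ) ^ 2) fun ω => by
        rw [abs_pow]
        exact pow_le_pow_left₀ (abs_nonneg _) (abs_segSum_le hb c d ω) 2
  have hIint c : Integrable (I c) μ := integrable_of_abs_le (hI c) (C := 1) fun ω => by
    rw [abs_of_nonneg (hI0 c ω)]; exact hI1 c ω
  have hIR c : Integrable (fun ω => I c ω * segSum x (c + m) b ω ^ 2) μ := by
    refine (hint (c + m) b).mono ((hI c).mul ((measurable_segSum hx _ _).pow_const 2)).aestronglyMeasurable
      (Eventually.of_forall fun ω => ?_)
    simp only [norm_mul, norm_pow, Real.norm_eq_abs, abs_of_nonneg (hI0 c ω)]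
    exact mul_le_of_le_one_left (by positivity) (hI1 c ω)
  have hp0 c : 0 ≤ ∫ ω, I c ω ∂μ := integral_nonneg (hI0 c)
  -- The exit event at `c` depends only on indices below `c`, so it is independent of the remainder
  -- started at `c + m`.
  have hERle c : ∫ ω, I c ω * segSum x (c + m) b ω ^ 2 ∂μ ≤ (∫ ω, I c ω ∂μ) * v := by
    by_cases hac : a < c
    · have hind : IndepFun (I c) (fun ω => segSum x (c + m) b ω ^ 2) μ := by
        refine hdep.indepFun c ?_ ?_
        · exact (@measurable_const _ _ _ (familySigma x (Set.Iio c)) (1 : ℝ)).indicator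
            (measurableSet_firstExit a l c)
        · refine Measurable.pow_const (measurable_segSum_familySigma fun i hi => ?_) 2
          exact (Finset.mem_Ico.1 hi).1
      rw [hind.integral_fun_mul_eq_mul_integral (hI c).aestronglyMeasurable
        (hint _ _).aestronglyMeasurable]
      exact mul_le_mul_of_nonneg_left (hv _ (by omega)) (hp0 c)
    · have : ∀ ω, I c ω = 0 := fun ω => Set.indicator_of_notMem
        (fun h => hac (abs_segSum_le_of_mem_firstExit hb hl.le h).1) _
      simp [this]
  have hgap c ω := abs_segSum_sub_segSum_le (x := x) (m := m) hδ hb c b ω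
  -- The block sum is at most `l + δ` up to the exit, `m * δ` over the gap, and the remainder:
  -- together at most `2 * l` plus the remainder. Beyond `3 * l` the remainder is therefore at least
  -- a third of the block sum, hence the factor `9 = 3 ^ 2`.
  have key1 : ∀ ω, {ω | 3 * l < |segSum x a b ω|}.indicator (fun ω => segSum x a b ω ^ 2) ω
      ≤ ∑ c ∈ Finset.range (b + 1), 9 * (I c ω * segSum x (c + m) b ω ^ 2) := by
    intro ω
    have hnn : ∀ c ∈ Finset.range (b + 1), 0 ≤ 9 * (I c ω * segSum x (c + m) b ω ^ 2) :=
      fun c _ => by have := hI0 c ω; positivity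
    refine Set.indicator_apply_le' (fun h => ?_) fun _ => Finset.sum_nonneg hnn
    have h : 3 * l < |segSum x a b ω| := h
    obtain ⟨c, hcb, hc⟩ := exists_mem_firstExit (x := x) (a := a) (b := b) (l := l) (ω := ω)
      (by linarith)
    refine le_trans ?_ (Finset.single_le_sum hnn (Finset.mem_range.2 (Nat.lt_succ_of_le hcb)))
    obtain ⟨hac, hTc⟩ := abs_segSum_le_of_mem_firstExit hb hl.le hc
    have hIc : I c ω = 1 := Set.indicator_of_mem hc _
    rw [hIc, one_mul]
    have hle : |segSum x a b ω| ≤ 2 * l + |segSum x (c + m) b ω| := by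
      rw [← segSum_add hac.le hcb]
      have h1 := abs_add_le (segSum x a c ω) (segSum x c b ω)
      have h2 := abs_add_le (segSum x c b ω - segSum x (c + m) b ω) (segSum x (c + m) b ω)
      rw [sub_add_cancel] at h2
      have h3 := hgap c ω
      linarith
    have hle3 : |segSum x a b ω| ≤ 3 * |segSum x (c + m) b ω| := by linarith
    rw [← sq_abs, ← sq_abs (segSum x (c + m) b ω)]
    nlinarith [abs_nonneg (segSum x a b ω)]
  -- After an exit, the block sum or the remainder is of order `l`. Integrating bounds the exit
  -- probability `P` by `9 * v / l ^ 2 * (1 + P)`, and `hvl` lets the term containing `P` be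
  -- absorbed.
  have key2 : ∀ ω, ∑ c ∈ Finset.range (b + 1), I c ω ≤ 9 / l ^ 2 * segSum x a b ω ^ 2
      + ∑ c ∈ Finset.range (b + 1), 9 / l ^ 2 * (I c ω * segSum x (c + m) b ω ^ 2) := by
    intro ω
    have hone : ∀ c ∈ Finset.range (b + 1), I c ω ≤ I c ω * (9 / l ^ 2 * segSum x a b ω ^ 2)
        + 9 / l ^ 2 * (I c ω * segSum x (c + m) b ω ^ 2) := by
      intro c hcb
      by_cases hc : ω ∈ firstExit x a l c
      · obtain ⟨hac, -⟩ := abs_segSum_le_of_mem_firstExit hb hl.le hc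
        have hIc : I c ω = 1 := Set.indicator_of_mem hc _
        rw [hIc, one_mul, one_mul]
        have hcb : c ≤ b := Nat.lt_succ_iff.1 (Finset.mem_range.1 hcb)
        have hsum : 2 * l / 3 ≤ |segSum x a b ω| + |segSum x (c + m) b ω| := by
          have h0 := segSum_add (x := x) hac.le hcb ω
          have h1 : segSum x a c ω = segSum x a b ω
            - (segSum x c b ω - segSum x (c + m) b ω) - segSum x (c + m) b ω := by
            rw [← h0]; ring
          have h2 := hc.2
          rw [h1] at h2
          have h3 := abs_sub (segSum x a b ω - (segSum x c b ω - segSum x (c + m) b ω))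
            (segSum x (c + m) b ω)
          have h4 := abs_sub (segSum x a b ω) (segSum x c b ω - segSum x (c + m) b ω)
          have h5 := hgap c ω
          linarith
        have hsq : l ^ 2 ≤ 9 * (segSum x a b ω ^ 2 + segSum x (c + m) b ω ^ 2) := by
          rw [← sq_abs (segSum x a b ω), ← sq_abs (segSum x (c + m) b ω)]
          nlinarith [sq_nonneg (|segSum x a b ω| - |segSum x (c + m) b ω|)]
        rw [← mul_add, div_mul_eq_mul_div, le_div_iff₀ (by positivity), one_mul]
        exact hsq
      · have hIc : I c ω = 0 := Set.indicator_of_notMem hc _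
        simp [hIc]
    refine (Finset.sum_le_sum hone).trans ?_
    rw [Finset.sum_add_distrib, ← Finset.sum_mul]
    refine add_le_add ?_ le_rfl
    exact mul_le_of_le_one_left (by positivity) (sum_indicator_firstExit_le_one a (b + 1) l ω)
  set P : ℝ := ∑ c ∈ Finset.range (b + 1), ∫ ω, I c ω ∂μ with hP
  have hP0 : 0 ≤ P := Finset.sum_nonneg fun c _ => hp0 c
  have hsumle : ∑ c ∈ Finset.range (b + 1), ∫ ω, I c ω * segSum x (c + m) b ω ^ 2 ∂μ ≤ P * v := by
    rw [hP, Finset.sum_mul]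
    exact Finset.sum_le_sum fun c _ => hERle c
  have hPle : P ≤ 18 * v / l ^ 2 := by
    have h1 : P ≤ 9 / l ^ 2 * v + 9 / l ^ 2 * (P * v) := by
      have := integral_mono (μ := μ) (integrable_finsetSum _ fun c _ => hIint c)
        (((hint a b).const_mul _).add
          (integrable_finsetSum _ fun c _ => (hIR c).const_mul (9 / l ^ 2))) key2
      rw [integral_finsetSum _ fun c _ => hIint c, ← hP] at this
      refine this.trans ?_
      simp only [Pi.add_apply]
      rw [integral_add ((hint a b).const_mul _)
          (integrable_finsetSum _ fun c _ => (hIR c).const_mul (9 / l ^ 2)),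
        integral_finsetSum _ fun c _ => (hIR c).const_mul (9 / l ^ 2)]
      simp only [integral_const_mul]
      rw [← Finset.mul_sum]
      gcongr
      exact hv a le_rfl
    have h2 : 9 / l ^ 2 * (P * v) ≤ P / 2 := by
      rw [div_mul_eq_mul_div, div_le_iff₀ (by positivity)]
      nlinarith
    have h3 : 18 * v / l ^ 2 = 2 * (9 / l ^ 2 * v) := by ring
    linarith
  have hv0 : 0 ≤ v := (integral_nonneg fun ω => sq_nonneg _).trans (hv a le_rfl)
  calc ∫ ω, {ω | 3 * l < |segSum x a b ω|}.indicator (fun ω => segSum x a b ω ^ 2) ω ∂μ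
      ≤ ∫ ω, ∑ c ∈ Finset.range (b + 1), 9 * (I c ω * segSum x (c + m) b ω ^ 2) ∂μ :=
        integral_mono ((hint a b).indicator (measurableSet_lt measurable_const
          (measurable_segSum hx a b).abs))
          (integrable_finsetSum _ fun c _ => (hIR c).const_mul 9) key1
    _ = 9 * ∑ c ∈ Finset.range (b + 1), ∫ ω, I c ω * segSum x (c + m) b ω ^ 2 ∂μ := by
        rw [integral_finsetSum _ fun c _ => (hIR c).const_mul 9, Finset.mul_sum]
        simp only [integral_const_mul]
    _ ≤ 9 * (18 * v / l ^ 2 * v) := by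
        gcongr
        exact hsumle.trans (mul_le_mul_of_nonneg_right hPle hv0)
    _ = 162 * v ^ 2 / l ^ 2 := by ring

end Segments

/-! ### Estimates for exponentials -/

theorem norm_cexp_mul_I_sub_one_le (y : ℝ) : ‖Complex.exp (y * Complex.I) - 1‖ ≤ |y| := by
  rw [mul_comm]
  exact Real.norm_exp_I_mul_ofReal_sub_one_le

theorem hasDerivAt_cexp_mul_I (y : ℝ) :
    HasDerivAt (fun y : ℝ => Complex.exp (y * Complex.I))
      (Complex.exp (y * Complex.I) * Complex.I) y := by
  simpa using ((Complex.ofRealCLM.hasDerivAt (x := y)).mul_const Complex.I).cexp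

/-- The derivative of this remainder is the preceding remainder times `Complex.I`, so the mean value
inequality gains a power of `|y|`. The cubic bound below repeats the argument; sharp constants are
not needed. -/
theorem norm_cexp_mul_I_sub_one_sub_le (y : ℝ) :
    ‖Complex.exp (y * Complex.I) - 1 - y * Complex.I‖ ≤ y ^ 2 := by
  have hd (z : ℝ) : HasDerivAt (fun y : ℝ => Complex.exp (y * Complex.I) - 1 - y * Complex.I)
      (Complex.exp (z * Complex.I) * Complex.I - Complex.I) z := by
    have h := ((hasDerivAt_cexp_mul_I z).sub_const 1).sub
      ((Complex.ofRealCLM.hasDerivAt (x := z)).mul_const Complex.I)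
    rw [Complex.ofRealCLM_apply, Complex.ofReal_one, one_mul] at h
    exact h
  have h := (convex_closedBall (0 : ℝ) |y|).norm_image_sub_le_of_norm_hasDerivWithin_le
    (C := |y|) (x := 0) (y := y) (fun z _ => (hd z).hasDerivWithinAt) (fun z hz => ?_)
    (by simp) (by simp)
  · simpa [← sq] using h
  · have hz : |z| ≤ |y| := by simpa using hz
    rw [← sub_one_mul, norm_mul, Complex.norm_I, mul_one]
    exact (norm_cexp_mul_I_sub_one_le z).trans hz

theorem norm_cexp_mul_I_sub_quadratic_le_cube (y : ℝ) :
    ‖Complex.exp (y * Complex.I) - 1 - y * Complex.I + (y ^ 2 / 2 : ℝ)‖ ≤ |y| ^ 3 := by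
  have hd (z : ℝ) : HasDerivAt
      (fun y : ℝ => Complex.exp (y * Complex.I) - 1 - y * Complex.I + (y ^ 2 / 2 : ℝ))
      ((Complex.exp (z * Complex.I) - 1 - z * Complex.I) * Complex.I) z := by
    have h2 : HasDerivAt (fun y : ℝ => ((y ^ 2 / 2 : ℝ) : ℂ)) (z : ℂ) z := by
      have h3 : HasDerivAt (fun y : ℝ => y ^ 2 / 2) z z := by
        simpa using (hasDerivAt_pow 2 z).div_const 2
      exact h3.ofReal_comp
    have h1 := (((hasDerivAt_cexp_mul_I z).sub_const 1).sub
      ((Complex.ofRealCLM.hasDerivAt (x := z)).mul_const Complex.I)).add h2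
    rw [Complex.ofRealCLM_apply, Complex.ofReal_one, one_mul] at h1
    refine h1.congr_deriv ?_
    linear_combination (z : ℂ) * Complex.I_sq
  have h := (convex_closedBall (0 : ℝ) |y|).norm_image_sub_le_of_norm_hasDerivWithin_le
    (C := |y| ^ 2) (x := 0) (y := y) (fun z _ => (hd z).hasDerivWithinAt) (fun z hz => ?_)
    (by simp) (by simp)
  · simpa [pow_succ] using h
  · have hz : |z| ≤ |y| := by simpa using hz
    rw [norm_mul, Complex.norm_I, mul_one]
    refine (norm_cexp_mul_I_sub_one_sub_le z).trans ?_
    rw [← sq_abs z]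
    gcongr

theorem norm_cexp_mul_I_sub_quadratic_le_sq (y : ℝ) :
    ‖Complex.exp (y * Complex.I) - 1 - y * Complex.I + (y ^ 2 / 2 : ℝ)‖ ≤ 2 * y ^ 2 := by
  refine (norm_add_le _ _).trans ?_
  have h := norm_cexp_mul_I_sub_one_sub_le y
  rw [Complex.norm_real, Real.norm_of_nonneg (by positivity)]
  nlinarith [sq_nonneg y]

theorem abs_exp_neg_sub_one_sub_le {u : ℝ} (hu : 0 ≤ u) : |Real.exp (-u) - (1 - u)| ≤ u ^ 2 := by
  rcases le_total u 1 with h | h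
  · have := Real.abs_exp_sub_one_sub_id_le (x := -u) (by rwa [abs_neg, abs_of_nonneg hu])
    rw [neg_sq] at this
    convert this using 2
    ring
  · have h1 := Real.add_one_le_exp (-u)
    have h2 : Real.exp (-u) ≤ 1 := Real.exp_le_one_iff.2 (by linarith)
    rw [abs_le]
    constructor <;> nlinarith

theorem abs_exp_neg_sub_exp_neg_le {u w : ℝ} (hu : 0 ≤ u) (hw : 0 ≤ w) :
    |Real.exp (-u) - Real.exp (-w)| ≤ |u - w| := by
  wlog h : u ≤ w generalizing u w
  · rw [abs_sub_comm, abs_sub_comm u]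
    exact this hw hu (le_of_not_ge h)
  have h1 : Real.exp (-w) = Real.exp (-u) * Real.exp (-(w - u)) := by
    rw [← Real.exp_add]; ring_nf
  have h2 := Real.add_one_le_exp (-(w - u))
  have h3 : Real.exp (-u) ≤ 1 := Real.exp_le_one_iff.2 (by linarith)
  have h4 := Real.exp_pos (-u)
  have h5 : Real.exp (-w) ≤ Real.exp (-u) := Real.exp_le_exp.2 (by linarith)
  rw [abs_of_nonneg (by linarith), abs_of_nonpos (by linarith), h1]
  nlinarith

/-! ### Characteristic functions of random variables -/

section CharFun

variable {Ω : Type*} [MeasurableSpace Ω] {μ : Measure Ω}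

/-- The characteristic function of a random variable. -/
noncomputable def rvCharFun (μ : Measure Ω) (S : Ω → ℝ) (t : ℝ) : ℂ :=
  ∫ ω, Complex.exp ((t * S ω : ℝ) * Complex.I) ∂μ

theorem rvCharFun_eq_charFun_map {S : Ω → ℝ} (hS : AEMeasurable S μ) (t : ℝ) :
    rvCharFun μ S t = charFun (μ.map S) t := by
  rw [charFun_apply_real, integral_map hS (by fun_prop), rvCharFun]
  simp

variable [IsProbabilityMeasure μ]

theorem integrable_cexp_mul_I {S : Ω → ℝ} (hS : Measurable S) (t : ℝ) :
    Integrable (fun ω => Complex.exp ((t * S ω : ℝ) * Complex.I)) μ :=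
  Integrable.of_bound (by fun_prop) 1
    (Eventually.of_forall fun ω => (Complex.norm_exp_ofReal_mul_I _).le)

theorem norm_rvCharFun_le_one (S : Ω → ℝ) (t : ℝ) : ‖rvCharFun μ S t‖ ≤ 1 := by
  have := norm_integral_le_of_norm_le_const (μ := μ)
    (Eventually.of_forall fun ω => (Complex.norm_exp_ofReal_mul_I (t * S ω)).le)
  rwa [probReal_univ, mul_one] at this

theorem ProbabilityTheory.IndepFun.rvCharFun_add {S T : Ω → ℝ} (h : IndepFun S T μ)
    (hS : Measurable S) (hT : Measurable T) (t : ℝ) :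
    rvCharFun μ (fun ω => S ω + T ω) t = rvCharFun μ S t * rvCharFun μ T t := by
  rw [rvCharFun_eq_charFun_map hS.aemeasurable, rvCharFun_eq_charFun_map hT.aemeasurable,
    rvCharFun_eq_charFun_map (hS.fun_add hT).aemeasurable]
  exact congrFun (h.charFun_map_fun_add_eq_mul hS.aemeasurable hT.aemeasurable) t

theorem norm_rvCharFun_sub_le {S T : Ω → ℝ} (hS : Measurable S) (hT : Measurable T)
    (hST : Integrable (fun ω => S ω - T ω) μ) (t : ℝ) :
    ‖rvCharFun μ S t - rvCharFun μ T t‖ ≤ |t| * ∫ ω, |S ω - T ω| ∂μ := by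
  rw [rvCharFun, rvCharFun, ← integral_sub (integrable_cexp_mul_I hS t)
    (integrable_cexp_mul_I hT t), ← integral_const_mul]
  refine norm_integral_le_of_norm_le (hST.abs.const_mul _) (Eventually.of_forall fun ω => ?_)
  have h : Complex.exp ((t * S ω : ℝ) * Complex.I) - Complex.exp ((t * T ω : ℝ) * Complex.I) =
      Complex.exp ((t * T ω : ℝ) * Complex.I) *
        (Complex.exp ((t * (S ω - T ω) : ℝ) * Complex.I) - 1) := by
    rw [mul_sub_one, ← Complex.exp_add]
    push_cast
    ring_nf
  simp only [h]
  rw [norm_mul, Complex.norm_exp_ofReal_mul_I, one_mul, ← abs_mul]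
  exact norm_cexp_mul_I_sub_one_le _

/-- Lindeberg's estimate: the Taylor remainder is bounded by its quadratic bound where `|S|` exceeds
`L`, and by its cubic bound elsewhere. -/
theorem norm_rvCharFun_sub_quadratic_le {S : Ω → ℝ} (hS : Measurable S) (h2 : MemLp S 2 μ)
    (h0 : ∫ ω, S ω ∂μ = 0) (t : ℝ) {L : ℝ} (hL : 0 ≤ L) :
    ‖rvCharFun μ S t - ((1 - t ^ 2 * (∫ ω, S ω ^ 2 ∂μ) / 2 : ℝ) : ℂ)‖ ≤
      2 * t ^ 2 * ∫ ω, {ω | L < |S ω|}.indicator (fun ω => S ω ^ 2) ω ∂μ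
        + |t| ^ 3 * L * ∫ ω, S ω ^ 2 ∂μ := by
  have hi1 : Integrable S μ := h2.integrable (by norm_num)
  have hi2 : Integrable (fun ω => S ω ^ 2) μ := h2.integrable_sq
  have hA : MeasurableSet {ω | L < |S ω|} := measurableSet_lt measurable_const hS.abs
  have hrepr : rvCharFun μ S t - ((1 - t ^ 2 * (∫ ω, S ω ^ 2 ∂μ) / 2 : ℝ) : ℂ) =
      ∫ ω, (Complex.exp ((t * S ω : ℝ) * Complex.I) - 1 - (t * S ω : ℝ) * Complex.I
        + ((t * S ω) ^ 2 / 2 : ℝ)) ∂μ := by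
    have hl : Integrable (fun ω => ((t * S ω : ℝ) : ℂ) * Complex.I) μ :=
      (hi1.const_mul t).ofReal.mul_const _
    have hq : Integrable (fun ω => (((t * S ω) ^ 2 / 2 : ℝ) : ℂ)) μ := by
      refine Integrable.ofReal ?_
      simp only [mul_pow]
      exact (hi2.const_mul (t ^ 2)).div_const 2
    have he := integrable_cexp_mul_I (μ := μ) hS t
    have he1 : Integrable (fun ω => Complex.exp ((t * S ω : ℝ) * Complex.I) - 1) μ :=
      he.sub (integrable_const 1)
    have he2 : Integrable (fun ω => Complex.exp ((t * S ω : ℝ) * Complex.I) - 1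
        - (t * S ω : ℝ) * Complex.I) μ := he1.sub hl
    rw [integral_add he2 hq, integral_sub he1 hl, integral_sub he (integrable_const 1),
      integral_mul_const, integral_complex_ofReal, integral_complex_ofReal, integral_const_mul, h0,
      integral_div]
    simp only [mul_pow]
    rw [integral_const_mul, rvCharFun]
    simp
    ring
  rw [hrepr, ← integral_const_mul, ← integral_const_mul, ← integral_add
    ((hi2.indicator hA).const_mul _) (hi2.const_mul _)]
  refine norm_integral_le_of_norm_le (((hi2.indicator hA).const_mul _).add (hi2.const_mul _))
    (Eventually.of_forall fun ω => ?_)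
  by_cases h : L < |S ω|
  · have hω : ω ∈ {ω | L < |S ω|} := h
    simp only [Set.indicator_of_mem hω]
    refine (norm_cexp_mul_I_sub_quadratic_le_sq _).trans ?_
    have : 0 ≤ |t| ^ 3 * L * S ω ^ 2 := by positivity
    nlinarith
  · have hω : ω ∉ {ω | L < |S ω|} := h
    simp only [Set.indicator_of_notMem hω, mul_zero, zero_add]
    refine (norm_cexp_mul_I_sub_quadratic_le_cube _).trans ?_
    rw [abs_mul, mul_pow, ← sq_abs (S ω), pow_succ |S ω|, mul_assoc, mul_comm L]
    have := not_lt.1 h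
    gcongr

end CharFun

/-! ### The characteristic function of a sum of small `m`-dependent variables -/

section Induction

variable {Ω : Type*} [MeasurableSpace Ω] {μ : Measure Ω}
  {x : ℕ → Ω → ℝ} {m : ℕ} {δ : ℝ}

theorem integral_segSum (hx : ∀ i, Integrable (x i) μ) (h0 : ∀ i, ∫ ω, x i ω ∂μ = 0) (a b : ℕ) :
    ∫ ω, segSum x a b ω ∂μ = 0 := by
  simp only [segSum]
  rw [integral_finsetSum _ fun i _ => hx i]
  simp [h0]

variable [IsProbabilityMeasure μ]

theorem memLp_segSum (hx : ∀ i, Measurable (x i)) (hb : ∀ i ω, |x i ω| ≤ δ) (a b : ℕ)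
    (p : ENNReal) : MemLp (segSum x a b) p μ :=
  MemLp.of_bound (measurable_segSum hx a b).aestronglyMeasurable _
    (Eventually.of_forall (abs_segSum_le hb a b))

/-- The characteristic function of a block whose proper initial segments have second moment below
`η`, and which itself has second moment at most `4 * η`. -/
theorem norm_rvCharFun_block_sub_le (hx : ∀ i, Measurable (x i)) (hdep : MDepSeq μ m x)
    (hδ : 0 ≤ δ) (hb : ∀ i ω, |x i ω| ≤ δ) (h0 : ∀ i, ∫ ω, x i ω ∂μ = 0) {a b : ℕ} {η l : ℝ}
    (hl : 0 < l) (hml : 3 * ((m + 1) * δ) ≤ l) (hηl : 180 * η ≤ l ^ 2)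
    (hlt : ∀ c, c < b → ∫ ω, segSum x a c ω ^ 2 ∂μ < η)
    (hle : ∫ ω, segSum x a b ω ^ 2 ∂μ ≤ 4 * η) (t : ℝ) :
    ‖rvCharFun μ (segSum x a b) t
        - (Real.exp (-(t ^ 2 * (∫ ω, segSum x a b ω ^ 2 ∂μ) / 2)) : ℂ)‖ ≤
      2 * t ^ 2 * (162 * (10 * η) ^ 2 / l ^ 2) + |t| ^ 3 * (3 * l) * (4 * η)
        + (2 * t ^ 2 * η) ^ 2 := by
  have hsq c d : Integrable (fun ω => segSum x c d ω ^ 2) μ := (memLp_segSum hx hb c d 2).integrable_sq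
  set v := ∫ ω, segSum x a b ω ^ 2 ∂μ with hvdef
  have hv0 : 0 ≤ v := integral_nonneg fun ω => sq_nonneg _
  have hη : 0 ≤ η := by linarith
  -- A final segment is the block minus an initial segment: `2 * (4 * η) + 2 * η = 10 * η`.
  have hv (c : ℕ) (hac : a ≤ c) : ∫ ω, segSum x c b ω ^ 2 ∂μ ≤ 10 * η := by
    rcases lt_or_ge c b with hcb | hcb
    · have h1 : ∫ ω, segSum x c b ω ^ 2 ∂μ ≤
          ∫ ω, (2 * segSum x a b ω ^ 2 + 2 * segSum x a c ω ^ 2) ∂μ := by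
        refine integral_mono (hsq c b) (((hsq a b).const_mul 2).add ((hsq a c).const_mul 2))
          fun ω => ?_
        have := segSum_add (x := x) hac hcb.le ω
        simp only [← this]
        nlinarith [sq_nonneg (2 * segSum x a c ω + segSum x c b ω)]
      rw [integral_add ((hsq a b).const_mul 2) ((hsq a c).const_mul 2), integral_const_mul,
        integral_const_mul] at h1
      linarith [hlt c hcb]
    · simp only [segSum_of_le hcb]
      simp only [ne_eq, OfNat.ofNat_ne_zero, not_false_eq_true, zero_pow, integral_zero]
      positivity
  have hblock := setIntegral_sq_segSum_le hx hdep hδ hb hl hml (v := 10 * η) (by linarith) hv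
  have hint i : Integrable (x i) μ := integrable_of_abs_le (hx i) (hb i)
  have htaylor := norm_rvCharFun_sub_quadratic_le (measurable_segSum hx a b)
    (memLp_segSum hx hb a b 2 (μ := μ)) (integral_segSum hint h0 a b) t (L := 3 * l) (by positivity)
  rw [← hvdef] at htaylor
  have hexp := abs_exp_neg_sub_one_sub_le (u := t ^ 2 * v / 2) (by positivity)
  have hu : (t ^ 2 * v / 2) ^ 2 ≤ (2 * t ^ 2 * η) ^ 2 := by
    refine pow_le_pow_left₀ (by positivity) ?_ 2
    nlinarith [sq_nonneg t]
  have htri : ‖rvCharFun μ (segSum x a b) t - (Real.exp (-(t ^ 2 * v / 2)) : ℂ)‖ ≤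
      ‖rvCharFun μ (segSum x a b) t - ((1 - t ^ 2 * v / 2 : ℝ) : ℂ)‖
        + |Real.exp (-(t ^ 2 * v / 2)) - (1 - t ^ 2 * v / 2)| := by
    rw [← Real.norm_eq_abs, ← Complex.norm_real, Complex.ofReal_sub (Real.exp _),
      norm_sub_rev (Real.exp _ : ℂ) ((1 - _ : ℝ) : ℂ)]
    exact norm_sub_le_norm_sub_add_norm_sub _ _ _
  have ha : 2 * t ^ 2 * ∫ ω, {ω | 3 * l < |segSum x a b ω|}.indicator
      (fun ω => segSum x a b ω ^ 2) ω ∂μ ≤ 2 * t ^ 2 * (162 * (10 * η) ^ 2 / l ^ 2) := by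
    gcongr
  have hb' : |t| ^ 3 * (3 * l) * v ≤ |t| ^ 3 * (3 * l) * (4 * η) := by gcongr
  linarith

/-- Induction on the length of the tail. `K` is the cost of one cut: the block error, plus the
effect of the gap on the characteristic function and on the Gaussian exponent. The error budget is
linear in the variance of the tail, with slope `2 / η * K`, so that a variance drop of `η / 2` pays
exactly `K`. -/
theorem norm_rvCharFun_tail_sub_le (hx : ∀ i, Measurable (x i)) (hdep : MDepSeq μ m x)
    (hδ : 0 ≤ δ) (hb : ∀ i ω, |x i ω| ≤ δ) (h0 : ∀ i, ∫ ω, x i ω ∂μ = 0) {η l : ℝ}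
    (hl : 0 < l) (hml : 3 * ((m + 1) * δ) ≤ l) (hηl : 180 * η ≤ l ^ 2) (hη : 0 < η)
    (hδη : δ ^ 2 ≤ η) (hmδη : 16 * (m * δ) ≤ η) (hmδ : m * δ ≤ 1) (t : ℝ) {K : ℝ}
    (hK : 2 * t ^ 2 * (162 * (10 * η) ^ 2 / l ^ 2) + |t| ^ 3 * (3 * l) * (4 * η)
        + (2 * t ^ 2 * η) ^ 2 + |t| * (m * δ) + t ^ 2 / 2 * (8 * (m * δ)) ≤ K) (N : ℕ) (a : ℕ)
    (hV : ∫ ω, segSum x a N ω ^ 2 ∂μ ≤ 2) :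
    ‖rvCharFun μ (segSum x a N) t
        - (Real.exp (-(t ^ 2 * (∫ ω, segSum x a N ω ^ 2 ∂μ) / 2)) : ℂ)‖ ≤
      2 * t ^ 2 * η + 2 / η * K * ∫ ω, segSum x a N ω ^ 2 ∂μ := by
  have hmδ0 : 0 ≤ (m : ℝ) * δ := by positivity
  have hK0 : 0 ≤ K := le_trans (by positivity) hK
  have hsq c d : Integrable (fun ω => segSum x c d ω ^ 2) μ := (memLp_segSum hx hb c d 2).integrable_sq
  have hint i : Integrable (x i) μ := integrable_of_abs_le (hx i) (hb i)
  have hmS c d : Measurable (segSum x c d) := measurable_segSum hx c d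
  induction hd : N - a using Nat.strong_induction_on generalizing a with
  | _ d ih =>
  by_cases hex : ∃ b, b ≤ N ∧ η ≤ ∫ ω, segSum x a b ω ^ 2 ∂μ
  · classical
    obtain ⟨hbN, hbη⟩ := Nat.find_spec hex
    have hmin := fun c (hc : c < Nat.find hex) => Nat.find_min hex hc
    generalize Nat.find hex = b at hbN hbη hmin
    have hab : a < b := by
      by_contra hba
      simp only [segSum_of_le (not_lt.1 hba)] at hbη
      simp at hbη
      linarith
    have hlt (c : ℕ) (hc : c < b) : ∫ ω, segSum x a c ω ^ 2 ∂μ < η := by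
      have := hmin c hc
      push Not at this
      exact this (hc.le.trans hbN)
    -- By minimality of `b` the second moment is below `η` before the last member, which adds at
    -- most `δ`; `2 * η + 2 * δ ^ 2 ≤ 4 * η`.
    have hle : ∫ ω, segSum x a b ω ^ 2 ∂μ ≤ 4 * η := by
      obtain ⟨e, rfl⟩ : ∃ e, b = e + 1 := ⟨b - 1, by omega⟩
      have h1 : ∫ ω, segSum x a (e + 1) ω ^ 2 ∂μ ≤
          ∫ ω, (2 * segSum x a e ω ^ 2 + 2 * δ ^ 2) ∂μ := by
        refine integral_mono (hsq _ _) (((hsq a e).const_mul 2).add (integrable_const _))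
          fun ω => ?_
        have h2 := segSum_add (x := x) (Nat.lt_succ_iff.1 hab) (Nat.le_succ e) ω
        have h3 : segSum x e (e + 1) ω = x e ω := by simp [segSum]
        rw [h3] at h2
        simp only [← h2]
        have h4 : x e ω ^ 2 ≤ δ ^ 2 := by
          rw [← sq_abs]
          exact pow_le_pow_left₀ (abs_nonneg _) (hb e ω) 2
        nlinarith [sq_nonneg (segSum x a e ω - x e ω)]
      rw [integral_add ((hsq a e).const_mul 2) (integrable_const _), integral_const_mul] at h1
      simp only [integral_const, probReal_univ, one_smul] at h1
      linarith [hlt e (Nat.lt_succ_self e)]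
    have hblock := norm_rvCharFun_block_sub_le hx hdep hδ hb h0 hl hml hηl hlt hle t
    have hindep : IndepFun (segSum x a b) (segSum x (b + m) N) μ := by
      refine hdep.indepFun b (measurable_segSum_familySigma fun i hi => ?_)
        (measurable_segSum_familySigma fun i hi => ?_)
      · exact (Finset.mem_Ico.1 hi).2
      · exact (Finset.mem_Ico.1 hi).1
    set V := ∫ ω, segSum x a N ω ^ 2 ∂μ with hVdef
    set v := ∫ ω, segSum x a b ω ^ 2 ∂μ with hvdef
    set V' := ∫ ω, segSum x (b + m) N ω ^ 2 ∂μ with hVdef'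
    have hv0 : 0 ≤ v := integral_nonneg fun ω => sq_nonneg _
    have hV0 : 0 ≤ V := integral_nonneg fun ω => sq_nonneg _
    have hV0' : 0 ≤ V' := integral_nonneg fun ω => sq_nonneg _
    -- `T` is the tail with the gap deleted; its two summands are independent and centred, so their
    -- second moments add.
    let T : Ω → ℝ := fun ω => segSum x a b ω + segSum x (b + m) N ω
    have hTm : Measurable T := (hmS _ _).add (hmS _ _)
    have hgap ω : |segSum x a N ω - T ω| ≤ m * δ := by
      have h1 := abs_segSum_sub_segSum_le (x := x) (m := m) hδ hb b N ω
      have h2 : segSum x a N ω - T ω = segSum x b N ω - segSum x (b + m) N ω := by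
        simp only [T, ← segSum_add hab.le hbN ω]
        ring
      rwa [h2]
    have hprodint : Integrable (fun ω => segSum x a b ω * segSum x (b + m) N ω) μ :=
      (memLp_segSum hx hb a b 2).integrable_mul (memLp_segSum hx hb (b + m) N 2)
    have hTsq : ∫ ω, T ω ^ 2 ∂μ = v + V' := by
      have h1 : ∀ ω, T ω ^ 2 = segSum x a b ω ^ 2 + segSum x (b + m) N ω ^ 2
          + 2 * (segSum x a b ω * segSum x (b + m) N ω) := fun ω => by simp only [T]; ring
      simp only [h1]
      have h2 : Integrable (fun ω => segSum x a b ω ^ 2 + segSum x (b + m) N ω ^ 2) μ :=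
        (hsq _ _).add (hsq _ _)
      rw [integral_add h2 (hprodint.const_mul 2),
        integral_add (hsq _ _) (hsq _ _), integral_const_mul,
        hindep.integral_fun_mul_eq_mul_integral (hmS _ _).aestronglyMeasurable
          (hmS _ _).aestronglyMeasurable, integral_segSum hint h0]
      ring
    have hVdiff : |V - (v + V')| ≤ 8 * (m * δ) := by
      rw [hVdef, ← hTsq]
      have hTsqint : Integrable (fun ω => T ω ^ 2) μ :=
        ((memLp_segSum hx hb a b 2).add (memLp_segSum hx hb (b + m) N 2)).integrable_sq
      rw [← integral_sub (hsq _ _) hTsqint, ← Real.norm_eq_abs]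
      refine (norm_integral_le_of_norm_le
        (g := fun ω => m * δ * (2 + segSum x a N ω ^ 2))
        (((integrable_const _).add (hsq a N)).const_mul _)
        (Eventually.of_forall fun ω => ?_)).trans ?_
      · have h1 := hgap ω
        have h2 : segSum x a N ω ^ 2 - T ω ^ 2 =
          (segSum x a N ω - T ω) * (2 * segSum x a N ω - (segSum x a N ω - T ω)) := by ring
        rw [h2, Real.norm_eq_abs, abs_mul]
        gcongr
        have h3 := abs_sub (2 * segSum x a N ω) (segSum x a N ω - T ω)
        rw [abs_mul, abs_two] at h3
        nlinarith [sq_abs (segSum x a N ω), sq_nonneg (|segSum x a N ω| - 1)]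
      · rw [integral_const_mul, integral_add (integrable_const _) (hsq a N)]
        simp only [integral_const, probReal_univ, one_smul]
        nlinarith
    have hVle : V' ≤ V - η / 2 := by
      have := abs_le.1 hVdiff
      linarith
    have htail := ih (N - (b + m)) (by omega) (b + m) (by linarith) rfl
    rw [← hVdef'] at htail
    have hcf1 : ‖rvCharFun μ (segSum x a N) t - rvCharFun μ T t‖ ≤ |t| * (m * δ) := by
      have hi : Integrable (fun ω => segSum x a N ω - T ω) μ :=
        integrable_of_abs_le ((hmS _ _).sub hTm) hgap
      refine (norm_rvCharFun_sub_le (hmS a N) hTm hi t).trans ?_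
      gcongr
      have := integral_mono hi.abs (integrable_const (m * δ)) hgap
      simpa using this
    have hcf2 : rvCharFun μ T t = rvCharFun μ (segSum x a b) t * rvCharFun μ (segSum x (b + m) N) t :=
      hindep.rvCharFun_add (hmS _ _) (hmS _ _) t
    have hexp : |Real.exp (-(t ^ 2 * v / 2)) * Real.exp (-(t ^ 2 * V' / 2))
        - Real.exp (-(t ^ 2 * V / 2))| ≤ t ^ 2 / 2 * (8 * (m * δ)) := by
      rw [← Real.exp_add, ← neg_add]
      refine (abs_exp_neg_sub_exp_neg_le (by positivity) (by positivity)).trans ?_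
      have : t ^ 2 * v / 2 + t ^ 2 * V' / 2 - t ^ 2 * V / 2 = -(t ^ 2 / 2 * (V - (v + V'))) := by
        ring
      rw [this, abs_neg, abs_mul, abs_of_nonneg (by positivity : 0 ≤ t ^ 2 / 2)]
      gcongr
    have hψ := norm_rvCharFun_le_one (μ := μ) (segSum x (b + m) N) t
    have hexp1 : ‖(Real.exp (-(t ^ 2 * v / 2)) : ℂ)‖ ≤ 1 := by
      rw [Complex.norm_real, Real.norm_of_nonneg (Real.exp_pos _).le]
      exact Real.exp_le_one_iff.2 (by have : 0 ≤ t ^ 2 * v / 2 := by positivity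
                                      linarith)
    rw [← Real.norm_eq_abs, ← Complex.norm_real] at hexp
    push_cast at hexp hexp1 htail hblock ⊢
    set φ := rvCharFun μ (segSum x a N) t
    set φT := rvCharFun μ T t
    set φB := rvCharFun μ (segSum x a b) t
    set ψ := rvCharFun μ (segSum x (b + m) N) t
    set eB := Complex.exp (-((t : ℂ) ^ 2 * v / 2))
    set eR := Complex.exp (-((t : ℂ) ^ 2 * V' / 2))
    set e := Complex.exp (-((t : ℂ) ^ 2 * V / 2))
    -- The four errors: deleting the gap, replacing the block, replacing the shorter tail (induction
    -- hypothesis), and the failure of variances to add exactly.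
    have hdecomp : φ - e = (φ - φT) + (φB - eB) * ψ + eB * (ψ - eR) + (eB * eR - e) := by
      rw [hcf2]; ring
    rw [hdecomp]
    have n1 : ‖(φB - eB) * ψ‖ ≤ ‖φB - eB‖ := by
      rw [norm_mul]; exact mul_le_of_le_one_right (norm_nonneg _) hψ
    have n2 : ‖eB * (ψ - eR)‖ ≤ ‖ψ - eR‖ := by
      rw [norm_mul]; exact mul_le_of_le_one_left (norm_nonneg _) hexp1
    have n3 := norm_add_le ((φ - φT) + (φB - eB) * ψ + eB * (ψ - eR)) (eB * eR - e)
    have n4 := norm_add_le ((φ - φT) + (φB - eB) * ψ) (eB * (ψ - eR))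
    have n5 := norm_add_le (φ - φT) ((φB - eB) * ψ)
    have n6 : K + 2 / η * K * V' ≤ 2 / η * K * V := by
      have h1 : 2 / η * K * V' ≤ 2 / η * K * (V - η / 2) := by gcongr
      have h2 : 2 / η * K * (V - η / 2) = 2 / η * K * V - K := by field_simp
      linarith
    linarith
  -- When no further block can be cut, the variance left is below `η`, and both functions are within
  -- a multiple of `t ^ 2 * η` of 1.
  · have hVη : ∫ ω, segSum x a N ω ^ 2 ∂μ < η := by
      by_contra hN
      exact hex ⟨N, le_rfl, not_lt.1 hN⟩
    set V := ∫ ω, segSum x a N ω ^ 2 ∂μ with hVdef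
    have hV0 : 0 ≤ V := integral_nonneg fun ω => sq_nonneg _
    have h1 : ‖rvCharFun μ (segSum x a N) t - 1‖ ≤ t ^ 2 * V := by
      have hli : Integrable (fun ω => ((t * segSum x a N ω : ℝ) : ℂ) * Complex.I) μ :=
        (((memLp_segSum hx hb a N 1).integrable le_rfl).const_mul t).ofReal.mul_const _
      have he := integrable_cexp_mul_I (μ := μ) (hmS a N) t
      have hrepr : rvCharFun μ (segSum x a N) t - 1 =
          ∫ ω, (Complex.exp ((t * segSum x a N ω : ℝ) * Complex.I) - 1
            - (t * segSum x a N ω : ℝ) * Complex.I) ∂μ := by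
        have he1 : Integrable (fun ω => Complex.exp ((t * segSum x a N ω : ℝ) * Complex.I) - 1) μ :=
          he.sub (integrable_const 1)
        rw [integral_sub he1 hli, integral_sub he (integrable_const 1),
          integral_mul_const, integral_complex_ofReal, integral_const_mul, integral_segSum hint h0,
          rvCharFun]
        simp
      rw [hrepr, hVdef, ← integral_const_mul]
      refine norm_integral_le_of_norm_le ((hsq a N).const_mul _) (Eventually.of_forall fun ω => ?_)
      rw [← mul_pow]
      exact norm_cexp_mul_I_sub_one_sub_le _
    have h2 : ‖1 - (Real.exp (-(t ^ 2 * V / 2)) : ℂ)‖ ≤ t ^ 2 * V / 2 := by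
      have h3 := abs_exp_neg_sub_exp_neg_le (u := 0) (w := t ^ 2 * V / 2) le_rfl (by positivity)
      rw [neg_zero, Real.exp_zero, zero_sub, abs_neg,
        abs_of_nonneg (by positivity : 0 ≤ t ^ 2 * V / 2), ← Real.norm_eq_abs,
        ← Complex.norm_real, Complex.ofReal_sub, Complex.ofReal_one] at h3
      exact h3
    have h4 := norm_sub_le_norm_sub_add_norm_sub (rvCharFun μ (segSum x a N) t) 1
      (Real.exp (-(t ^ 2 * V / 2)) : ℂ)
    have h5 : t ^ 2 * V ≤ t ^ 2 * η := by gcongr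
    have h6 : 0 ≤ 2 / η * K * V := by positivity
    have h7 : 0 ≤ t ^ 2 * η := by positivity
    linarith

end Induction

/-! ### Bounded variables: uniform normal approximation -/

theorem exists_bound_norm_rvCharFun_segSum_sub_le (m : ℕ) (t : ℝ) {ρ : ℝ} (hρ : 0 < ρ) :
    ∃ δ : ℝ, 0 < δ ∧ ∀ {Ω : Type*} [MeasurableSpace Ω] (μ : Measure Ω) [IsProbabilityMeasure μ]
      (x : ℕ → Ω → ℝ) (N : ℕ), (∀ i, Measurable (x i)) → MDepSeq μ m x →
      (∀ i ω, |x i ω| ≤ δ) → (∀ i, ∫ ω, x i ω ∂μ = 0) →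
      |∫ ω, segSum x 0 N ω ^ 2 ∂μ - 1| ≤ δ →
      ‖rvCharFun μ (segSum x 0 N) t - (Real.exp (-(t ^ 2 / 2)) : ℂ)‖ ≤ ρ := by
  -- The scales are `η = l ^ 4` and `(m + 1) * δ = l ^ 5`. The terms of one cut are then of order `l
  -- ^ 6`, `l ^ 5`, `l ^ 8`, `l ^ 5`, `l ^ 5`, with coefficients collected in `C`, and `O(1 / l ^
  -- 4)` cuts cost `O(l)` in total.
  set C : ℝ := 32400 * t ^ 2 + 12 * |t| ^ 3 + 4 * t ^ 4 + |t| + 4 * t ^ 2 with hC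
  have hC0 : 0 ≤ C := by positivity
  obtain ⟨l, hl, hl32, hlρ⟩ : ∃ l : ℝ, 0 < l ∧ l ≤ 1 / 32 ∧ l * (1 + 3 * t ^ 2 + 4 * C) ≤ ρ := by
    have hpos : 0 < 1 + 3 * t ^ 2 + 4 * C := by positivity
    refine ⟨min (1 / 32) (ρ / (1 + 3 * t ^ 2 + 4 * C)), by positivity, min_le_left _ _, ?_⟩
    rw [← le_div_iff₀ hpos]
    exact min_le_right _ _
  have hl1 : l ≤ 1 := by linarith
  set δ : ℝ := l ^ 5 / (m + 1) with hδ
  have hδ0 : 0 < δ := by positivity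
  have hm1 : ((m : ℝ) + 1) * δ = l ^ 5 := by rw [hδ]; field_simp
  have hmδ : m * δ ≤ l ^ 5 := by nlinarith
  have hδl : δ ≤ l ^ 5 := by
    have : 0 ≤ (m : ℝ) * δ := by positivity
    linarith
  have h5l : l ^ 5 ≤ l := pow_le_of_le_one hl.le hl1 (by norm_num)
  have h54 : l ^ 5 ≤ l ^ 4 / 32 := by
    rw [pow_succ]
    nlinarith [pow_pos hl 4]
  have h65 : l ^ 6 ≤ l ^ 5 := pow_le_pow_of_le_one hl.le hl1 (by norm_num)
  have h85 : l ^ 8 ≤ l ^ 5 := pow_le_pow_of_le_one hl.le hl1 (by norm_num)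
  refine ⟨δ, hδ0, fun {Ω} _ μ _ x N hx hdep hb h0 hV => ?_⟩
  have hVle : ∫ ω, segSum x 0 N ω ^ 2 ∂μ ≤ 2 := by
    have := (abs_le.1 hV).2
    linarith
  have hV0 : 0 ≤ ∫ ω, segSum x 0 N ω ^ 2 ∂μ := integral_nonneg fun ω => sq_nonneg _
  have hη : 3 * (((m : ℝ) + 1) * δ) ≤ l := by
    rw [hm1, pow_succ]
    have : l ^ 4 ≤ 1 / 3 := (pow_le_pow_left₀ hl.le hl32 4).trans (by norm_num)
    nlinarith
  have h180 : 180 * l ^ 4 ≤ l ^ 2 := by nlinarith [pow_pos hl 2]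
  have hsq : δ ^ 2 ≤ l ^ 4 := by
    have h1 : δ ^ 2 ≤ (l ^ 5) ^ 2 := pow_le_pow_left₀ hδ0.le hδl 2
    rw [← pow_mul] at h1
    exact h1.trans (pow_le_pow_of_le_one hl.le hl1 (by norm_num))
  have hK : 2 * t ^ 2 * (162 * (10 * l ^ 4) ^ 2 / l ^ 2) + |t| ^ 3 * (3 * l) * (4 * l ^ 4)
      + (2 * t ^ 2 * l ^ 4) ^ 2 + |t| * (m * δ) + t ^ 2 / 2 * (8 * (m * δ)) ≤ C * l ^ 5 := by
    have e1 : 2 * t ^ 2 * (162 * (10 * l ^ 4) ^ 2 / l ^ 2) = 32400 * t ^ 2 * l ^ 6 := by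
      field_simp
      ring
    have e2 : |t| ^ 3 * (3 * l) * (4 * l ^ 4) = 12 * |t| ^ 3 * l ^ 5 := by ring
    have e3 : (2 * t ^ 2 * l ^ 4) ^ 2 = 4 * t ^ 4 * l ^ 8 := by ring
    have e4 : t ^ 2 / 2 * (8 * (m * δ)) = 4 * t ^ 2 * (m * δ) := by ring
    rw [e1, e2, e3, e4, hC]
    simp only [add_mul]
    gcongr
  have hmain := norm_rvCharFun_tail_sub_le hx hdep hδ0.le hb h0 hl hη h180 (by positivity) hsq
    (by linarith) (by linarith) t hK N 0 hVle
  set V := ∫ ω, segSum x 0 N ω ^ 2 ∂μ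
  have hexp : ‖(Real.exp (-(t ^ 2 * V / 2)) : ℂ) - (Real.exp (-(t ^ 2 / 2)) : ℂ)‖
      ≤ t ^ 2 * l := by
    rw [← Complex.ofReal_sub, Complex.norm_real, Real.norm_eq_abs]
    refine (abs_exp_neg_sub_exp_neg_le (by positivity) (by positivity)).trans ?_
    have h1 : t ^ 2 * V / 2 - t ^ 2 / 2 = t ^ 2 / 2 * (V - 1) := by ring
    rw [h1, abs_mul, abs_of_nonneg (by positivity : 0 ≤ t ^ 2 / 2)]
    have h2 : t ^ 2 / 2 * |V - 1| ≤ t ^ 2 / 2 * l := by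
      gcongr
      linarith
    have h3 : 0 ≤ t ^ 2 * l := by positivity
    linarith
  have htri := norm_sub_le_norm_sub_add_norm_sub (rvCharFun μ (segSum x 0 N) t)
    (Real.exp (-(t ^ 2 * V / 2)) : ℂ) (Real.exp (-(t ^ 2 / 2)) : ℂ)
  have hb1 : 2 / l ^ 4 * (C * l ^ 5) * V ≤ 4 * C * l := by
    have h1 : 2 / l ^ 4 * (C * l ^ 5) = 2 * C * l := by field_simp
    rw [h1]
    have h2 : 0 ≤ C * l := by positivity
    nlinarith
  have hb2 : 2 * t ^ 2 * l ^ 4 ≤ 2 * t ^ 2 * l := by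
    gcongr
    exact pow_le_of_le_one hl.le hl1 (by norm_num)
  linarith

/-! ### Truncation -/

section Truncation

variable {Ω : Type*} [MeasurableSpace Ω] {μ : Measure Ω} {m : ℕ}

theorem memLp_two_segSum {x : ℕ → Ω → ℝ} (h : ∀ i, MemLp (x i) 2 μ) (a b : ℕ) :
    MemLp (segSum x a b) 2 μ :=
  memLp_finsetSum _ fun i _ => h i

/-- The second moment of a sum of centred `m`-dependent variables is at most `2 * m + 1` times the
sum of their second moments. -/
theorem integral_sq_segSum_le {u : ℕ → Ω → ℝ} (hdep : MDepSeq μ m u)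
    (h2 : ∀ i, MemLp (u i) 2 μ) (h0 : ∀ i, ∫ ω, u i ω ∂μ = 0) (N : ℕ) :
    ∫ ω, segSum u 0 N ω ^ 2 ∂μ ≤ (2 * m + 1) * ∑ i ∈ Finset.range N, ∫ ω, u i ω ^ 2 ∂μ := by
  have hint i j : Integrable (fun ω => u i ω * u j ω) μ := (h2 i).integrable_mul (h2 j)
  have hsq i : Integrable (fun ω => u i ω ^ 2) μ := (h2 i).integrable_sq
  have hfar {i j : ℕ} (hij : i + m < j) : ∫ ω, u i ω * u j ω ∂μ = 0 := by
    have hind : IndepFun (u i) (u j) μ :=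
      hdep.indepFun (i + 1) (measurable_familySigma (Set.mem_Iio.2 (Nat.lt_succ_self i)))
        (measurable_familySigma (Set.mem_Ici.2 (by omega)))
    rw [hind.integral_fun_mul_eq_mul_integral (h2 i).aestronglyMeasurable
      (h2 j).aestronglyMeasurable, h0, zero_mul]
  set e : ℕ → ℝ := fun i => ∫ ω, u i ω ^ 2 ∂μ with he
  have he0 i : 0 ≤ e i := integral_nonneg fun ω => sq_nonneg _
  -- Pairs more than `m` apart are uncorrelated; for the others the product is at most half the sum
  -- of squares. The second condition is written with `i` and `j` exchanged so that `hrow` serves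
  -- both sums after swapping the order of summation.
  have hterm (i j : ℕ) : ∫ ω, u i ω * u j ω ∂μ ≤
      (if i ≤ j + m ∧ j ≤ i + m then e i / 2 else 0)
        + (if j ≤ i + m ∧ i ≤ j + m then e j / 2 else 0) := by
    by_cases h : i ≤ j + m ∧ j ≤ i + m
    · rw [if_pos h, if_pos h.symm]
      have h1 := integral_mono (hint i j) (((hsq i).div_const 2).add ((hsq j).div_const 2))
        fun ω => by
          change u i ω * u j ω ≤ u i ω ^ 2 / 2 + u j ω ^ 2 / 2
          nlinarith [sq_nonneg (u i ω - u j ω)]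
      simp only [Pi.add_apply] at h1
      rwa [integral_add ((hsq i).div_const 2) ((hsq j).div_const 2), integral_div,
        integral_div] at h1
    · rw [if_neg h, if_neg fun h' => h h'.symm, add_zero]
      rcases not_and_or.1 h with h | h
      · simp only [mul_comm (u i _)]
        exact (hfar (not_le.1 h)).le
      · exact (hfar (not_le.1 h)).le
  have hrow (i : ℕ) : ∑ j ∈ Finset.range N, (if i ≤ j + m ∧ j ≤ i + m then e i / 2 else 0)
      ≤ (2 * m + 1) * (e i / 2) := by
    rw [← Finset.sum_filter, Finset.sum_const, nsmul_eq_mul]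
    have hcard : ((Finset.range N).filter fun j => i ≤ j + m ∧ j ≤ i + m).card ≤ 2 * m + 1 := by
      refine (Finset.card_le_card (t := Finset.Icc (i - m) (i + m)) fun j hj => ?_).trans ?_
      · have := (Finset.mem_filter.1 hj).2
        exact Finset.mem_Icc.2 (by omega)
      · rw [Nat.card_Icc]
        omega
    have hcard' : (((Finset.range N).filter fun j => i ≤ j + m ∧ j ≤ i + m).card : ℝ)
        ≤ 2 * m + 1 := by exact_mod_cast hcard
    exact mul_le_mul_of_nonneg_right hcard' (div_nonneg (he0 i) zero_le_two)
  have hexpand (ω : Ω) : segSum u 0 N ω ^ 2 =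
      ∑ i ∈ Finset.range N, ∑ j ∈ Finset.range N, u i ω * u j ω := by
    rw [segSum, Nat.Ico_zero_eq_range, sq, Finset.sum_mul_sum]
  simp only [hexpand]
  rw [integral_finsetSum _ fun i _ => integrable_finsetSum _ fun j _ => hint i j]
  simp only [integral_finsetSum _ fun j _ => hint _ j]
  calc ∑ i ∈ Finset.range N, ∑ j ∈ Finset.range N, ∫ ω, u i ω * u j ω ∂μ
      ≤ ∑ i ∈ Finset.range N, ∑ j ∈ Finset.range N,
        ((if i ≤ j + m ∧ j ≤ i + m then e i / 2 else 0)
          + (if j ≤ i + m ∧ i ≤ j + m then e j / 2 else 0)) :=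
        Finset.sum_le_sum fun i _ => Finset.sum_le_sum fun j _ => hterm i j
    _ = ∑ i ∈ Finset.range N, ∑ j ∈ Finset.range N,
          (if i ≤ j + m ∧ j ≤ i + m then e i / 2 else 0)
        + ∑ j ∈ Finset.range N, ∑ i ∈ Finset.range N,
          (if j ≤ i + m ∧ i ≤ j + m then e j / 2 else 0) := by
        simp only [Finset.sum_add_distrib]
        congr 1
        exact Finset.sum_comm
    _ ≤ ∑ i ∈ Finset.range N, (2 * m + 1) * (e i / 2)
        + ∑ i ∈ Finset.range N, (2 * m + 1) * (e i / 2) :=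
        add_le_add (Finset.sum_le_sum fun i _ => hrow i) (Finset.sum_le_sum fun i _ => hrow i)
    _ = (2 * m + 1) * ∑ i ∈ Finset.range N, e i := by
        rw [← Finset.mul_sum, ← Finset.sum_div]
        ring

end Truncation

/-- `ε` and `κ` are chosen before the probability space and the row, so a single pair serves every
`n`. -/
theorem exists_lindeberg_norm_rvCharFun_segSum_sub_le (m : ℕ) (t : ℝ) {ρ : ℝ} (hρ : 0 < ρ) :
    ∃ ε > 0, ∃ κ > 0, ∀ {Ω : Type*} [MeasurableSpace Ω] (μ : Measure Ω) [IsProbabilityMeasure μ]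
      (y : ℕ → Ω → ℝ) (N : ℕ), (∀ i, Measurable (y i)) → MDepSeq μ m y →
      (∀ i, MemLp (y i) 2 μ) → (∀ i, ∫ ω, y i ω ∂μ = 0) →
      ∫ ω, segSum y 0 N ω ^ 2 ∂μ = 1 →
      ∑ i ∈ Finset.range N, ∫ ω, {ω | ε < |y i ω|}.indicator (fun ω => y i ω ^ 2) ω ∂μ ≤ κ →
      ‖rvCharFun μ (segSum y 0 N) t - (Real.exp (-(t ^ 2 / 2)) : ℂ)‖ ≤ ρ := by
  obtain ⟨δ, hδ, hmain⟩ := exists_bound_norm_rvCharFun_segSum_sub_le m t (half_pos hρ)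
  obtain ⟨r, hr, hrρ⟩ : ∃ r : ℝ, 0 < r ∧ |t| * (2 * r) ≤ ρ / 2 := by
    refine ⟨ρ / (4 * (|t| + 1)), by positivity, ?_⟩
    have h1 : |t| * (2 * (ρ / (4 * (|t| + 1)))) = ρ / 2 * (|t| / (|t| + 1)) := by
      field_simp
      ring
    rw [h1]
    exact mul_le_of_le_one_right (by positivity) (by rw [div_le_one₀] <;> linarith [abs_nonneg t])
  -- `D` will bound the second moment of the removed sum. The first condition keeps the variance of
  -- the truncated sum within `δ` of 1; the second makes the first absolute moment of the removed
  -- sum at most `2 * r`.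
  obtain ⟨D, hD, hDδ, hDr⟩ : ∃ D : ℝ, 0 < D ∧ D * (1 + 2 / δ) ≤ δ / 2 ∧ D ≤ r ^ 2 := by
    have hpos : 0 < 1 + 2 / δ := by positivity
    refine ⟨min (δ / 2 / (1 + 2 / δ)) (r ^ 2), by positivity, ?_, min_le_right _ _⟩
    rw [← le_div_iff₀ hpos]
    exact min_le_left _ _
  refine ⟨δ / 2, half_pos hδ, D / (2 * m + 1), by positivity,
    fun {Ω} _ μ _ y N hy hdep h2 h0 hvar hL => ?_⟩
  let f : ℝ → ℝ := fun s => {s | δ / 2 < |s|}ᶜ.indicator id s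
  have hset : MeasurableSet {s : ℝ | δ / 2 < |s|} := measurableSet_lt measurable_const measurable_norm
  have hf : Measurable f := measurable_id.indicator hset.compl
  have hfb (s : ℝ) : |f s| ≤ δ / 2 := by
    by_cases h : δ / 2 < |s|
    · have : f s = 0 := Set.indicator_of_notMem (by simpa using h) _
      rw [this, abs_zero]
      positivity
    · have : f s = s := Set.indicator_of_mem (s := {s : ℝ | δ / 2 < |s|}ᶜ) h _
      rw [this]
      exact not_lt.1 h
  have hfsq (s : ℝ) : (s - f s) ^ 2 = {s : ℝ | δ / 2 < |s|}.indicator (fun s => s ^ 2) s := by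
    by_cases h : δ / 2 < |s|
    · have h1 : f s = 0 := Set.indicator_of_notMem (by simpa using h) _
      rw [h1, sub_zero, Set.indicator_of_mem (s := {s : ℝ | δ / 2 < |s|}) h]
    · have h1 : f s = s := Set.indicator_of_mem (s := {s : ℝ | δ / 2 < |s|}ᶜ) h _
      rw [h1, sub_self, Set.indicator_of_notMem (s := {s : ℝ | δ / 2 < |s|}) h]
      norm_num
  let c : ℕ → ℝ := fun i => ∫ ω, f (y i ω) ∂μ
  have hfy i : Measurable fun ω => f (y i ω) := hf.comp (hy i)
  have hfint i : Integrable (fun ω => f (y i ω)) μ := integrable_of_abs_le (hfy i) fun ω => hfb _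
  have hc i : |c i| ≤ δ / 2 := by
    have := norm_integral_le_of_norm_le_const (μ := μ) (f := fun ω => f (y i ω))
      (Eventually.of_forall fun ω => hfb (y i ω))
    rwa [probReal_univ, mul_one] at this
  let z : ℕ → Ω → ℝ := fun i => (fun s => f s - c i) ∘ y i
  let u : ℕ → Ω → ℝ := fun i => (fun s => s - (f s - c i)) ∘ y i
  have hyint i : Integrable (y i) μ := (h2 i).integrable one_le_two
  have hz i : Measurable (z i) := (hf.sub_const _).comp (hy i)
  have hzdep : MDepSeq μ m z := hdep.comp fun i => hf.sub_const _
  have hudep : MDepSeq μ m u := hdep.comp fun i => measurable_id.sub (hf.sub_const _)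
  have hzb i ω : |z i ω| ≤ δ := by
    have h1 := abs_sub (f (y i ω)) (c i)
    have h2 := hfb (y i ω)
    have h3 := hc i
    change |f (y i ω) - c i| ≤ δ
    linarith
  have hz0 i : ∫ ω, z i ω ∂μ = 0 := by
    change ∫ ω, (f (y i ω) - c i) ∂μ = 0
    rw [integral_sub (hfint i) (integrable_const _)]
    simp [c]
  have hz2 i : MemLp (z i) 2 μ :=
    MemLp.of_bound (hz i).aestronglyMeasurable δ (Eventually.of_forall (hzb i))
  have hu2 i : MemLp (u i) 2 μ := (h2 i).sub (hz2 i)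
  have hu0 i : ∫ ω, u i ω ∂μ = 0 := by
    change ∫ ω, (y i ω - z i ω) ∂μ = 0
    rw [integral_sub (hyint i) ((hz2 i).integrable one_le_two), h0, hz0, sub_zero]
  -- As `y i` is centred, `u i` is the centring of the part of `y i` above the truncation level, and
  -- centring only lowers the second moment.
  have husq i : ∫ ω, u i ω ^ 2 ∂μ ≤
      ∫ ω, {ω | δ / 2 < |y i ω|}.indicator (fun ω => y i ω ^ 2) ω ∂μ := by
    have hg2 : MemLp (fun ω => y i ω - f (y i ω)) 2 μ :=
      (h2 i).sub (MemLp.of_bound (hfy i).aestronglyMeasurable (δ / 2)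
        (Eventually.of_forall fun ω => hfb _))
    have hg0 : ∫ ω, (y i ω - f (y i ω)) ∂μ = -c i := by
      rw [integral_sub (hyint i) (hfint i), h0, zero_sub]
    have h1 (ω : Ω) : u i ω ^ 2 = (y i ω - f (y i ω)) ^ 2
        + (2 * c i * (y i ω - f (y i ω)) + c i ^ 2) := by
      change (y i ω - (f (y i ω) - c i)) ^ 2 = _
      ring
    have h3 : Integrable (fun ω => 2 * c i * (y i ω - f (y i ω)) + c i ^ 2) μ :=
      ((hg2.integrable one_le_two).const_mul _).add (integrable_const _)
    simp only [h1]
    rw [integral_add hg2.integrable_sq h3, integral_add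
      ((hg2.integrable one_le_two).const_mul _) (integrable_const _), integral_const_mul, hg0]
    simp only [hfsq, integral_const, probReal_univ, one_smul]
    have h4 : ∫ ω, {s : ℝ | δ / 2 < |s|}.indicator (fun s => s ^ 2) (y i ω) ∂μ =
        ∫ ω, {ω | δ / 2 < |y i ω|}.indicator (fun ω => y i ω ^ 2) ω ∂μ := rfl
    rw [h4]
    nlinarith [sq_nonneg (c i)]
  have hU : ∫ ω, segSum u 0 N ω ^ 2 ∂μ ≤ D := by
    refine (integral_sq_segSum_le hudep hu2 hu0 N).trans ?_
    have h1 := (Finset.sum_le_sum fun i (_ : i ∈ Finset.range N) => husq i).trans hL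
    rwa [le_div_iff₀' (by positivity)] at h1
  have hsub (ω : Ω) : segSum y 0 N ω - segSum z 0 N ω = segSum u 0 N ω := by
    simp only [segSum, ← Finset.sum_sub_distrib]
    rfl
  have hYsq := (memLp_two_segSum h2 0 N).integrable_sq
  have hZsq := (memLp_two_segSum hz2 0 N).integrable_sq
  have hUsq := (memLp_two_segSum hu2 0 N).integrable_sq
  have hUint := (memLp_two_segSum hu2 0 N).integrable one_le_two
  have hvarz : |∫ ω, segSum z 0 N ω ^ 2 ∂μ - 1| ≤ δ := by
    rw [← hvar, ← integral_sub hZsq hYsq, ← Real.norm_eq_abs]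
    refine (norm_integral_le_of_norm_le
      -- With `Z = S - U`, the difference `Z ^ 2 - S ^ 2` is `U ^ 2 - 2 * S * U`, and the cross term
      -- is split by a weighted AM-GM inequality.
      (g := fun ω => (1 + 2 / δ) * segSum u 0 N ω ^ 2 + δ / 2 * segSum y 0 N ω ^ 2)
      ((hUsq.const_mul _).add (hYsq.const_mul _)) (Eventually.of_forall fun ω => ?_)).trans ?_
    · have h1 : segSum z 0 N ω = segSum y 0 N ω - segSum u 0 N ω := by rw [← hsub]; ring
      rw [h1, Real.norm_eq_abs]
      generalize segSum u 0 N ω = U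
      generalize segSum y 0 N ω = S
      have h2 : 0 ≤ δ / 2 * S ^ 2 + 2 / δ * U ^ 2 - 2 * (S * U) := by
        have : δ / 2 * S ^ 2 + 2 / δ * U ^ 2 - 2 * (S * U) = 2 / δ * (δ / 2 * S - U) ^ 2 := by
          field_simp
          ring
        rw [this]; positivity
      have h3 : 0 ≤ δ / 2 * S ^ 2 + 2 / δ * U ^ 2 + 2 * (S * U) := by
        have : δ / 2 * S ^ 2 + 2 / δ * U ^ 2 + 2 * (S * U) = 2 / δ * (δ / 2 * S + U) ^ 2 := by
          field_simp
          ring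
        rw [this]; positivity
      rw [abs_le]
      constructor <;> nlinarith [sq_nonneg U]
    · rw [integral_add (hUsq.const_mul _) (hYsq.const_mul _), integral_const_mul,
        integral_const_mul, hvar]
      have h1 : (1 + 2 / δ) * ∫ ω, segSum u 0 N ω ^ 2 ∂μ ≤ (1 + 2 / δ) * D := by gcongr
      linarith
  have hcfz := hmain μ z N hz hzdep hzb hz0 hvarz
  have hcf : ‖rvCharFun μ (segSum y 0 N) t - rvCharFun μ (segSum z 0 N) t‖ ≤ ρ / 2 := by
    have hi : Integrable (fun ω => segSum y 0 N ω - segSum z 0 N ω) μ := by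
      simp only [hsub]
      exact hUint
    refine (norm_rvCharFun_sub_le (measurable_segSum hy 0 N) (measurable_segSum hz 0 N) hi t).trans
      (le_trans ?_ hrρ)
    gcongr
    simp only [hsub]
    have h1 : ∫ ω, |segSum u 0 N ω| ∂μ ≤ ∫ ω, (r + 1 / r * segSum u 0 N ω ^ 2) ∂μ := by
      refine integral_mono hUint.abs ((integrable_const _).add (hUsq.const_mul _)) fun ω => ?_
      change |segSum u 0 N ω| ≤ r + 1 / r * segSum u 0 N ω ^ 2
      rw [← sq_abs]
      generalize |segSum u 0 N ω| = w
      have h2 : r + 1 / r * w ^ 2 - w = 1 / r * ((w - r / 2) ^ 2 + 3 / 4 * r ^ 2) := by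
        field_simp
        ring
      have h3 : 0 ≤ 1 / r * ((w - r / 2) ^ 2 + 3 / 4 * r ^ 2) := by positivity
      linarith
    rw [integral_add (integrable_const _) (hUsq.const_mul _), integral_const_mul] at h1
    simp only [integral_const, probReal_univ, one_smul] at h1
    have h4 : 1 / r * ∫ ω, segSum u 0 N ω ^ 2 ∂μ ≤ 1 / r * r ^ 2 := by
      gcongr
      exact hU.trans hDr
    have h5 : 1 / r * r ^ 2 = r := by field_simp
    linarith
  have := norm_sub_le_norm_sub_add_norm_sub (rvCharFun μ (segSum y 0 N) t)
    (rvCharFun μ (segSum z 0 N) t) (Real.exp (-(t ^ 2 / 2)) : ℂ)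
  linarith

/-! ### Finite sequences -/

section NormalizedRow

variable {Ω : Type*} {N : ℕ}

/-- A finite sequence of random variables divided by `s` and continued by zeros. -/
noncomputable def normalizedRow (X : Fin N → Ω → ℝ) (s : ℝ) (i : ℕ) (ω : Ω) : ℝ :=
  if h : i < N then X ⟨i, h⟩ ω / s else 0

variable {X : Fin N → Ω → ℝ} {s : ℝ}

theorem normalizedRow_of_lt {i : ℕ} (h : i < N) :
    normalizedRow X s i = fun ω => X ⟨i, h⟩ ω / s := by
  ext ω
  simp [normalizedRow, h]

theorem normalizedRow_of_le {i : ℕ} (h : N ≤ i) : normalizedRow X s i = fun _ => 0 := by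
  ext ω
  simp [normalizedRow, not_lt.2 h]

theorem segSum_normalizedRow (ω : Ω) : segSum (normalizedRow X s) 0 N ω = rowSum X ω / s := by
  rw [segSum, Nat.Ico_zero_eq_range, Finset.sum_range, rowSum, Finset.sum_div]
  exact Finset.sum_congr rfl fun i _ => congrFun (normalizedRow_of_lt i.2) ω

variable [MeasurableSpace Ω] {μ : Measure Ω} {m : ℕ}

theorem measurable_normalizedRow (hX : ∀ i, Measurable (X i)) (i : ℕ) :
    Measurable (normalizedRow X s i) := by
  rcases lt_or_ge i N with h | h
  · rw [normalizedRow_of_lt h]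
    exact (hX _).div_const s
  · rw [normalizedRow_of_le h]
    exact measurable_const

theorem memLp_normalizedRow (hX : ∀ i, MemLp (X i) 2 μ) (i : ℕ) :
    MemLp (normalizedRow X s i) 2 μ := by
  rcases lt_or_ge i N with h | h
  · rw [normalizedRow_of_lt h]
    simpa only [div_eq_mul_inv] using (hX ⟨i, h⟩).mul_const s⁻¹
  · rw [normalizedRow_of_le h]
    exact MemLp.zero'

theorem integral_normalizedRow (hX : ∀ i, ∫ ω, X i ω ∂μ = 0) (i : ℕ) :
    ∫ ω, normalizedRow X s i ω ∂μ = 0 := by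
  rcases lt_or_ge i N with h | h
  · rw [normalizedRow_of_lt h, integral_div, hX, zero_div]
  · rw [normalizedRow_of_le h, integral_zero]

/-- The zeros used as padding are measurable for every σ-algebra, so they do not affect
independence. -/
theorem IsMDependent.mDepSeq_normalizedRow (h : IsMDependent μ m X) :
    MDepSeq μ m (normalizedRow X s) := by
  intro k
  refine indep_of_indep_of_le ((IndepFun_iff_Indep _ _ _).1 (h k))
    (iSup₂_le fun i hi => ?_) (iSup₂_le fun i hi => ?_)
  · refine Measurable.comap_le ?_
    rcases lt_or_ge i N with hN | hN
    · rw [normalizedRow_of_lt hN]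
      exact (Measurable.comp (g := fun p : {i : Fin N // (i : ℕ) < k} → ℝ => p ⟨⟨i, hN⟩, hi⟩)
        (measurable_pi_apply _) (comap_measurable _)).div_const s
    · rw [normalizedRow_of_le hN]
      exact measurable_const
  · refine Measurable.comap_le ?_
    rcases lt_or_ge i N with hN | hN
    · rw [normalizedRow_of_lt hN]
      exact (Measurable.comp (g := fun p : {i : Fin N // k + m ≤ (i : ℕ)} → ℝ => p ⟨⟨i, hN⟩, hi⟩)
        (measurable_pi_apply _) (comap_measurable _)).div_const s
    · rw [normalizedRow_of_le hN]
      exact measurable_const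

theorem sum_integral_indicator_normalizedRow (hs : 0 < s) (ε : ℝ) :
    ∑ i ∈ Finset.range N, ∫ ω, {ω | ε < |normalizedRow X s i ω|}.indicator
        (fun ω => normalizedRow X s i ω ^ 2) ω ∂μ =
      1 / s ^ 2 * ∑ i, ∫ ω, {ω | ε * s < |X i ω|}.indicator (fun ω => X i ω ^ 2) ω ∂μ := by
  rw [Finset.sum_range, Finset.mul_sum]
  refine Finset.sum_congr rfl fun i _ => ?_
  rw [normalizedRow_of_lt i.2, ← integral_const_mul]
  refine integral_congr_ae (Eventually.of_forall fun ω => ?_)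
  have hiff : ε < |X i ω / s| ↔ ε * s < |X i ω| := by
    rw [abs_div, abs_of_pos hs, lt_div_iff₀ hs]
  simp only [Set.indicator_apply, Set.mem_ofPred_eq, Fin.eta, hiff]
  split_ifs
  · ring
  · ring

end NormalizedRow

/-! ### The central limit theorem. -/

theorem theorem1 (m : ℕ) (N : ℕ → ℕ)
    {Ω : ℕ → Type*} [∀ n, MeasurableSpace (Ω n)]
    (μ : (n : ℕ) → Measure (Ω n)) [∀ n, IsProbabilityMeasure (μ n)]
    (X : (n : ℕ) → Fin (N n) → Ω n → ℝ)
    (hmeas : ∀ n i, Measurable (X n i))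
    (hdep : ∀ n, IsMDependent (μ n) m (X n))
    (hL2 : ∀ n i, MemLp (X n i) 2 (μ n))
    (hmean : ∀ n i, ∫ ω, X n i ω ∂(μ n) = 0)
    (hvar : ∀ᶠ n in atTop, 0 < Var[rowSum (X n); μ n])
    (hLindeberg : ∀ ε : ℝ, 0 < ε →
      Tendsto
        (fun n => 1 / Var[rowSum (X n); μ n] *
          ∑ i, ∫ ω, {ω | ε * rowSd (μ n) (X n) < |X n i ω|}.indicator
            (fun ω => X n i ω ^ 2) ω ∂(μ n))
        atTop (𝓝 0)) :
    TendstoInDistribution (fun n ω => rowSum (X n) ω / rowSd (μ n) (X n)) atTop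
      (id : ℝ → ℝ) μ (gaussianReal 0 1) := by
  have hmeasS n : Measurable (rowSum (X n)) := Finset.measurable_fun_sum _ fun i _ => hmeas n i
  refine ⟨fun n => ((hmeasS n).div_const _).aemeasurable, by fun_prop, ?_⟩
  refine ProbabilityMeasure.tendsto_iff_tendsto_charFun.2 fun t => ?_
  have hlim : charFun ((gaussianReal 0 1).map (id : ℝ → ℝ)) t =
      (Real.exp (-(t ^ 2 / 2)) : ℂ) := by
    rw [Measure.map_id, charFun_gaussianReal]
    push_cast
    congr 1
    simp
  simp only [ProbabilityMeasure.coe_mk, hlim]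
  refine Metric.tendsto_nhds.2 fun ρ hρ => ?_
  -- For given `t` and `ρ` the Lindeberg condition is needed at one `ε` only; `ρ / 2` makes the
  -- final inequality strict.
  obtain ⟨ε, hε, κ, hκ, hmain⟩ := exists_lindeberg_norm_rvCharFun_segSum_sub_le m t (half_pos hρ)
  filter_upwards [hvar, (hLindeberg ε hε).eventually_le_const hκ] with n hn hL
  have hs : 0 < rowSd (μ n) (X n) := Real.sqrt_pos.2 hn
  have hs2 : rowSd (μ n) (X n) ^ 2 = Var[rowSum (X n); μ n] := Real.sq_sqrt hn.le
  have hsum : segSum (normalizedRow (X n) (rowSd (μ n) (X n))) 0 (N n) =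
      fun ω => rowSum (X n) ω / rowSd (μ n) (X n) := funext segSum_normalizedRow
  have hmeanS : ∫ ω, rowSum (X n) ω ∂(μ n) = 0 := by
    simp only [rowSum]
    rw [integral_finsetSum _ fun i _ => (hL2 n i).integrable one_le_two]
    simp [hmean]
  have hone : ∫ ω, segSum (normalizedRow (X n) (rowSd (μ n) (X n))) 0 (N n) ω ^ 2 ∂(μ n) = 1 := by
    simp only [hsum, div_pow]
    rw [integral_div, hs2, variance_of_integral_eq_zero (hmeasS n).aemeasurable hmeanS]
    rw [variance_of_integral_eq_zero (hmeasS n).aemeasurable hmeanS] at hn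
    exact div_self hn.ne'
  have hbound := hmain (μ n) (normalizedRow (X n) (rowSd (μ n) (X n))) (N n)
    (measurable_normalizedRow (hmeas n)) (hdep n).mDepSeq_normalizedRow
    (memLp_normalizedRow (hL2 n)) (integral_normalizedRow (hmean n)) hone
    (by rwa [sum_integral_indicator_normalizedRow hs, hs2])
  rw [hsum, rvCharFun_eq_charFun_map ((hmeasS n).div_const _).aemeasurable] at hbound
  rw [dist_eq_norm]
  linarith
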